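/- Let $k$ be a perfect field; a $k$-variety is an integral separated scheme of finite type over $k$. Let $f\colon X\to Y$ be a finite, surjective and separable $k$-morphism of normal projective $k$-varieties (separable means that the field extension $k(Y)\subseteq k(X)$ is separable). Then for every $\mathbb{Q}$-divisor $D$ on $Y$, i.e. every element $D\in \mathrm{Div}(Y)\otimes_{\mathbb Z}\mathbb{Q}$, where $\mathrm{Div}(Y)$ is the group of Cartier divisors on $Y$, there is an equality of reduced closed subschemes of $X$ \[ \mathbf{B}(f^*D) = f^{-1}\mathbf{B}(D). \] Here, for a Cartier divisor $L$, the stable base locus is $\mathbf{B}(L) = \bigl(\bigcap_{m\ge 1}\mathrm{Bs}(mL)\bigr)_{\mathrm{red}}$, where $\mathrm{Bs}(mL)$ is the base locus of the complete linear system $|mL|$, i.e. the set of points at which all global sections of $\mathcal{O}(mL)$ vanish. For a $\mathbb{Q}$-divisor $D$, $\mathbf{B}(D) := \mathbf{B}(bD)$ for any integer $b>0$ such that $bD$ is Cartier (this does not depend on $b$). Finally, $f^{-1}\mathbf{B}(D)$ denotes the reduced scheme associated to the scheme-theoretic inverse image of $\mathbf{B}(D)$. -/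

import Mathlib

open AlgebraicGeometry CategoryTheory TopologicalSpace

universe u

noncomputable section

namespace BaseLoci

/-! ### Projective, normal and separable -/

section Projective

attribute [local instance] MvPolynomial.gradedAlgebra

/-- Projective `n`-space `Proj k[x₀, …, xₙ]` over `k`. -/
def projectiveSpace (k : Type u) [Field k] (n : ℕ) : Scheme.{u} :=
  Proj (MvPolynomial.homogeneousSubmodule (Fin (n + 1)) k)

/-- The structure morphism of projective `n`-space over `k`. -/
def projectiveSpaceStr (k : Type u) [Field k] (n : ℕ) :
    projectiveSpace k n ⟶ Spec (CommRingCat.of k) :=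
  Proj.toSpecZero (MvPolynomial.homogeneousSubmodule (Fin (n + 1)) k) ≫
    Spec.map (CommRingCat.ofHom
      (algebraMap k (MvPolynomial.homogeneousSubmodule (Fin (n + 1)) k 0)))

end Projective

/-- A `k`-scheme is projective if it is isomorphic, over `k`, to a closed subscheme of some
projective space over `k`. Such a scheme is separated and of finite type over `k`. -/
def IsProjective (k : Type u) [Field k] (X : Scheme.{u}) [X.Over (Spec (CommRingCat.of k))] :
    Prop :=
  ∃ (n : ℕ) (i : X ⟶ projectiveSpace k n), IsClosedImmersion i ∧
    i ≫ projectiveSpaceStr k n = X ↘ Spec (CommRingCat.of k)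

/-- An integral scheme is normal if all of its local rings are integrally closed domains. -/
def IsNormal (X : Scheme.{u}) [IsIntegral X] : Prop :=
  ∀ x : X, IsIntegrallyClosed (X.presheaf.stalk x)

variable {X Y : Scheme.{u}} [IsIntegral X] [IsIntegral Y]

lemma genericPoint_map (f : X ⟶ Y) [IsDominant f] : f (genericPoint X) = genericPoint Y := by
  apply ((genericPoint_spec Y).eq _).symm
  have h := (genericPoint_spec X).image f.continuous
  rwa [Set.image_univ, f.denseRange.closure_range] at h

/-- The inclusion of function fields `k(Y) → k(X)` induced by a dominant morphism `X ⟶ Y`. -/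
def functionFieldMap (f : X ⟶ Y) [IsDominant f] : Y.functionField →+* X.functionField :=
  (Y.presheaf.stalkSpecializes (specializes_of_eq (genericPoint_map f)) ≫
    f.stalkMap (genericPoint X)).hom

/-- A dominant morphism of integral schemes is (generically) separable if the induced extension
of function fields is a separable algebraic extension. -/
def IsSeparableMorphism (f : X ⟶ Y) [IsDominant f] : Prop :=
  letI : Algebra Y.functionField X.functionField := (functionFieldMap f).toAlgebra
  Algebra.IsSeparable Y.functionField X.functionField

lemma functionFieldMap_algebraMap (f : X ⟶ Y) [IsDominant f] (x : X)
    (a : Y.presheaf.stalk (f x)) :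
    functionFieldMap f (algebraMap (Y.presheaf.stalk (f x)) Y.functionField a) =
      algebraMap (X.presheaf.stalk x) X.functionField (f.stalkMap x a) := by
  have h := f.stalkSpecializes_stalkMap (genericPoint X) x
    ((genericPoint_spec X).specializes trivial)
  have h2 := congr($h a)
  have h3 : Y.presheaf.stalkSpecializes ((genericPoint_spec Y).specializes trivial) ≫
      Y.presheaf.stalkSpecializes (specializes_of_eq (genericPoint_map f)) =
      Y.presheaf.stalkSpecializes
        (((genericPoint_spec X).specializes (Set.mem_univ x)).map f.continuous) := by
    simp
  have h4 := congr($h3 a)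
  simp only [CommRingCat.comp_apply] at h2 h4
  simp only [RingHom.algebraMap_toAlgebra, functionFieldMap, CommRingCat.comp_apply]
  rw [← h2, ← h4]

/-! ### Cartier divisors -/

variable (Y) in
/-- The image of `𝒪_{Y,y}ˣ` in `k(Y)ˣ`. -/
def stalkUnits (y : Y) : Subgroup (Y.functionField)ˣ :=
  (Units.map (algebraMap (Y.presheaf.stalk y) Y.functionField).toMonoidHom).range

variable (Y) in
/-- The group `Γ(Y, 𝒦ˣ/𝒪ˣ)`, written multiplicatively. On the integral scheme `Y` the sheaf `𝒦`
is the constant sheaf `k(Y)` and the stalk of `𝒦ˣ/𝒪ˣ` at `y` is `k(Y)ˣ/𝒪_{Y,y}ˣ`; a global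
section of the quotient sheaf is a family of elements of the stalks that is locally given by
one rational function. -/
def cartierGroup : Subgroup (∀ y : Y, (Y.functionField)ˣ ⧸ stalkUnits Y y) where
  carrier := {L | ∀ y : Y, ∃ U : Y.Opens, y ∈ U ∧ ∃ φ : (Y.functionField)ˣ,
    ∀ z ∈ U, L z = QuotientGroup.mk φ}
  mul_mem' := by
    intro L M hL hM y
    obtain ⟨U, hU, φ, hφ⟩ := hL y
    obtain ⟨V, hV, ψ, hψ⟩ := hM y
    exact ⟨U ⊓ V, ⟨hU, hV⟩, φ * ψ, fun z hz => by
      rw [Pi.mul_apply, hφ z hz.1, hψ z hz.2]; rfl⟩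
  one_mem' := fun y => ⟨⊤, trivial, 1, fun z _ => rfl⟩
  inv_mem' := by
    intro L hL y
    obtain ⟨U, hU, φ, hφ⟩ := hL y
    exact ⟨U, hU, φ⁻¹, fun z hz => by rw [Pi.inv_apply, hφ z hz]; rfl⟩

variable (Y) in
/-- The additive group `Div(Y)` of Cartier divisors on the integral scheme `Y`. -/
def CartierDivisor : Type u := Additive (cartierGroup Y)

instance : AddCommGroup (CartierDivisor Y) :=
  inferInstanceAs (AddCommGroup (Additive (cartierGroup Y)))

/-- `φ ∈ k(Y)ˣ` is a local equation of the Cartier divisor `L` at `y`. -/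
def IsLocalEquation (L : CartierDivisor Y) (y : Y) (φ : (Y.functionField)ˣ) : Prop :=
  (Additive.toMul L).1 y = QuotientGroup.mk φ

lemma stalkUnits_le_comap (f : X ⟶ Y) [IsDominant f] (x : X) :
    stalkUnits Y (f x) ≤
      (stalkUnits X x).comap (Units.map (functionFieldMap f).toMonoidHom) := by
  intro c hc
  obtain ⟨a, rfl⟩ := MonoidHom.mem_range.1 hc
  refine Subgroup.mem_comap.2
    (MonoidHom.mem_range.2 ⟨Units.map (f.stalkMap x).hom.toMonoidHom a, ?_⟩)
  ext
  exact (functionFieldMap_algebraMap f x a).symm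

/-- The map `k(Y)ˣ/𝒪_{Y,f(x)}ˣ → k(X)ˣ/𝒪_{X,x}ˣ` induced by `f`. -/
def stalkPullback (f : X ⟶ Y) [IsDominant f] (x : X) :
    (Y.functionField)ˣ ⧸ stalkUnits Y (f x) →* (X.functionField)ˣ ⧸ stalkUnits X x :=
  QuotientGroup.map _ _ (Units.map (functionFieldMap f).toMonoidHom) (stalkUnits_le_comap f x)

/-- The pullback of Cartier divisors along a dominant morphism of integral schemes: a local
equation `φ` of `L` at `f x` gives the local equation `f^* φ` of `f^* L` at `x`. -/
def pullback (f : X ⟶ Y) [IsDominant f] : CartierDivisor Y →+ CartierDivisor X :=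
  MonoidHom.toAdditive (α := cartierGroup Y) (β := cartierGroup X)
    { toFun := fun L => ⟨fun x => stalkPullback f x (L.1 (f x)), by
        intro x
        obtain ⟨U, hU, φ, hφ⟩ := L.2 (f x)
        refine ⟨f ⁻¹ᵁ U, hU, Units.map (functionFieldMap f).toMonoidHom φ, fun z hz => ?_⟩
        exact congrArg (stalkPullback f z) (hφ (f z) hz)⟩
      map_one' := Subtype.ext (funext fun x => map_one (stalkPullback f x))
      map_mul' := fun L M => Subtype.ext (funext fun x => map_mul (stalkPullback f x) _ _) }

/-! ### Base loci of Cartier divisors -/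

/-- `H⁰(Y, 𝒪_Y(L))` as a subgroup of `k(Y)`: the rational functions `g` such that `g φ` is regular
at `y` whenever `φ` is a local equation of `L` at `y`. -/
def globalSections (L : CartierDivisor Y) : AddSubgroup Y.functionField where
  carrier := {g | ∀ (y : Y) (φ : (Y.functionField)ˣ), IsLocalEquation L y φ →
    ∃ a : Y.presheaf.stalk y, algebraMap _ Y.functionField a = g * φ}
  add_mem' := by
    intro g h hg hh y φ hφ
    obtain ⟨a, ha⟩ := hg y φ hφ
    obtain ⟨b, hb⟩ := hh y φ hφ
    exact ⟨a + b, by rw [map_add, ha, hb, add_mul]⟩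
  zero_mem' := fun y φ _ => ⟨0, by simp⟩
  neg_mem' := by
    intro g hg y φ hφ
    obtain ⟨a, ha⟩ := hg y φ hφ
    exact ⟨-a, by rw [map_neg, ha, neg_mul]⟩

/-- The section `g` of `𝒪_Y(L)` vanishes at `y`: in terms of a local equation `φ` of `L` at `y`,
the germ `g φ` lies in the maximal ideal of `𝒪_{Y,y}`. -/
def VanishesAt (L : CartierDivisor Y) (g : Y.functionField) (y : Y) : Prop :=
  ∀ φ : (Y.functionField)ˣ, IsLocalEquation L y φ →
    ∃ a ∈ IsLocalRing.maximalIdeal (Y.presheaf.stalk y),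
      algebraMap _ Y.functionField a = g * φ

lemma exists_isLocalEquation (L : CartierDivisor Y) (y : Y) : ∃ φ, IsLocalEquation L y φ := by
  obtain ⟨U, hU, φ, hφ⟩ := (Additive.toMul L).2 y
  exact ⟨φ, hφ y hU⟩

lemma algebraMap_stalk_injective (y : Y) :
    Function.Injective (algebraMap (Y.presheaf.stalk y) Y.functionField) :=
  IsFractionRing.injective _ _

/-- A section does not vanish at `y` iff its germ in terms of some local equation is a unit. -/
lemma not_vanishesAt_iff {L : CartierDivisor Y} {g : Y.functionField}
    (hg : g ∈ globalSections L) (y : Y) :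
    ¬ VanishesAt L g y ↔ ∃ φ, IsLocalEquation L y φ ∧
      ∃ u : (Y.presheaf.stalk y)ˣ, algebraMap _ Y.functionField (u : Y.presheaf.stalk y) = g * φ := by
  constructor
  · intro h
    simp only [VanishesAt, not_forall] at h
    obtain ⟨φ, hφ, h⟩ := h
    obtain ⟨a, ha⟩ := hg y φ hφ
    have hu : IsUnit a := by
      by_contra hn
      exact h ⟨a, (IsLocalRing.mem_maximalIdeal a).2 hn, ha⟩
    exact ⟨φ, hφ, hu.unit, ha⟩
  · rintro ⟨φ, hφ, u, hu⟩ h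
    obtain ⟨a, ham, ha⟩ := h φ hφ
    have : a = u := algebraMap_stalk_injective y (ha.trans hu.symm)
    exact (IsLocalRing.mem_maximalIdeal a).1 ham (this ▸ u.isUnit)

lemma algebraMap_germ (y : Y) (U : Y.Opens) (hy : y ∈ U) (hgen : genericPoint Y ∈ U)
    (s : Γ(Y, U)) : algebraMap (Y.presheaf.stalk y) Y.functionField (Y.presheaf.germ U y hy s) =
      Y.presheaf.germ U (genericPoint Y) hgen s := by
  simp [RingHom.algebraMap_toAlgebra, ← ConcreteCategory.comp_apply]

lemma isOpen_nonvanishing {L : CartierDivisor Y} {g : Y.functionField}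
    (hg : g ∈ globalSections L) : IsOpen {y | ¬ VanishesAt L g y} := by
  rw [isOpen_iff_forall_mem_open]
  intro y hy
  obtain ⟨φ, hφ, u, hu⟩ := (not_vanishesAt_iff hg y).1 hy
  obtain ⟨U, hyU, ψ, hψ⟩ := (Additive.toMul L).2 y
  -- replace `φ` by the local equation `ψ`, valid on all of `U`
  obtain ⟨c, hc⟩ : φ⁻¹ * ψ ∈ stalkUnits Y y := QuotientGroup.eq.1 (hφ.symm.trans (hψ y hyU))
  have hu' : algebraMap _ Y.functionField ((u * c : (Y.presheaf.stalk y)ˣ) : Y.presheaf.stalk y)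
      = g * ψ := by
    have hc' : algebraMap _ Y.functionField (c : Y.presheaf.stalk y) =
        ((φ⁻¹ * ψ : (Y.functionField)ˣ) : Y.functionField) := congrArg Units.val hc
    rw [Units.val_mul, map_mul, hu, hc', Units.val_mul, mul_assoc, ← mul_assoc (φ : Y.functionField),
      Units.mul_inv, one_mul]
  obtain ⟨V, hyV, s, hs⟩ := Y.presheaf.exists_germ_eq
    ((u * c : (Y.presheaf.stalk y)ˣ) : Y.presheaf.stalk y)
  have hmem : ∀ W : Y.Opens, ∀ z ∈ W, genericPoint Y ∈ W := fun W z hz =>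
    ((genericPoint_spec Y).mem_open_set_iff W.isOpen).2 ⟨z, trivial, hz⟩
  refine ⟨(Y.basicOpen s ⊓ U : Y.Opens), ?_, (Y.basicOpen s ⊓ U).isOpen, ?_, hyU⟩
  · rintro z ⟨hzs, hzU⟩
    have hzV : z ∈ V := Y.basicOpen_le s hzs
    have hunit := (Scheme.mem_basicOpen Y s z hzV).1 hzs
    refine (not_vanishesAt_iff hg z).2 ⟨ψ, hψ z hzU, hunit.unit, ?_⟩
    rw [← hu', ← hs, IsUnit.unit_spec, algebraMap_germ z V hzV (hmem V z hzV),
      algebraMap_germ y V hyV (hmem V z hzV)]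
  · refine (Scheme.mem_basicOpen Y s y hyV).2 ?_
    rw [hs]
    exact Units.isUnit _

/-- The base locus of the complete linear system `|L|`, as a closed subset: the common zeros of
all global sections of `𝒪_Y(L)`. -/
def baseLocus (L : CartierDivisor Y) : Closeds Y where
  carrier := {y | ∀ g ∈ globalSections L, VanishesAt L g y}
  isClosed' := by
    rw [← isOpen_compl_iff]
    have : {y | ∀ g ∈ globalSections L, VanishesAt L g y}ᶜ =
        ⋃ g : globalSections L, {y | ¬ VanishesAt L g.1 y} := by
      ext y; simp
    rw [this]
    exact isOpen_iUnion fun g => isOpen_nonvanishing g.2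

/-- The stable base locus of a Cartier divisor, as a closed subset: the intersection of the base
loci of all its positive multiples. -/
def stableBaseSet (L : CartierDivisor Y) : Closeds Y :=
  ⨅ m : ℕ+, baseLocus ((m : ℕ) • L)

/-! ### `ℚ`-divisors and their stable base loci -/

open scoped TensorProduct

variable (Y) in
/-- The group `Div(Y) ⊗ ℚ` of `ℚ`-divisors. -/
abbrev QDivisor : Type u := CartierDivisor Y ⊗[ℤ] ℚ

/-- The pullback of `ℚ`-divisors along a dominant morphism of integral schemes. -/
def QDivisor.pullback (f : X ⟶ Y) [IsDominant f] : QDivisor Y →ₗ[ℤ] QDivisor X :=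
  (BaseLoci.pullback f).toIntLinearMap.rTensor ℚ

/-- The stable base locus of a `ℚ`-divisor `D`, as a closed subset: it is the stable base locus
of the Cartier divisor `L` for every `b > 0` and `L` such that `b D = L` in `Div(Y) ⊗ ℚ`. As this
does not depend on `b` and `L` (see `QDivisor.stableBaseSet_eq` and `QDivisor.exists_cartier`), we
take the intersection over all choices. -/
def QDivisor.stableBaseSet (D : QDivisor Y) : Closeds Y :=
  ⨅ (b : ℕ+) (L : CartierDivisor Y) (_ : (b : ℕ) • D = L ⊗ₜ[ℤ] (1 : ℚ)), BaseLoci.stableBaseSet L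

lemma isLocalEquation_nsmul {L : CartierDivisor Y} {y : Y} {φ : (Y.functionField)ˣ}
    (h : IsLocalEquation L y φ) (n : ℕ) : IsLocalEquation (n • L) y (φ ^ n) := by
  change ((Additive.toMul L).1 y) ^ n = _
  rw [show (Additive.toMul L).1 y = QuotientGroup.mk φ from h]
  rfl

lemma exists_regular_of_isLocalEquation {L : CartierDivisor Y} {y : Y}
    {φ ψ : (Y.functionField)ˣ} (hφ : IsLocalEquation L y φ) (hψ : IsLocalEquation L y ψ)
    {g : Y.functionField} (h : ∃ a : Y.presheaf.stalk y, algebraMap _ Y.functionField a = g * φ) :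
    ∃ a : Y.presheaf.stalk y, algebraMap _ Y.functionField a = g * ψ := by
  obtain ⟨a, ha⟩ := h
  obtain ⟨c, hc⟩ : φ⁻¹ * ψ ∈ stalkUnits Y y := QuotientGroup.eq.1 (hφ.symm.trans hψ)
  have hc' : algebraMap _ Y.functionField (c : Y.presheaf.stalk y) =
      ((φ⁻¹ * ψ : (Y.functionField)ˣ) : Y.functionField) := congrArg Units.val hc
  refine ⟨a * c, ?_⟩
  rw [map_mul, ha, hc', Units.val_mul, mul_assoc, ← mul_assoc (φ : Y.functionField),
    Units.mul_inv, one_mul]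

lemma baseLocus_nsmul_le (L : CartierDivisor Y) (n : ℕ) :
    baseLocus (n • L) ≤ baseLocus L := by
  intro y hy g hg
  by_contra hv
  obtain ⟨φ, hφ, u, hu⟩ := (not_vanishesAt_iff hg y).1 hv
  have hgn : g ^ n ∈ globalSections (n • L) := by
    intro z ψ hψ
    obtain ⟨χ, hχ⟩ := exists_isLocalEquation L z
    obtain ⟨a, ha⟩ := hg z χ hχ
    exact exists_regular_of_isLocalEquation (isLocalEquation_nsmul hχ n) hψ
      ⟨a ^ n, by rw [map_pow, ha, mul_pow, Units.val_pow_eq_pow_val]⟩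
  refine (not_vanishesAt_iff hgn y).2 ⟨φ ^ n, isLocalEquation_nsmul hφ n, u ^ n, ?_⟩ (hy _ hgn)
  rw [Units.val_pow_eq_pow_val, map_pow, hu, mul_pow, Units.val_pow_eq_pow_val]

lemma stableBaseSet_nsmul (L : CartierDivisor Y) (n : ℕ+) :
    stableBaseSet ((n : ℕ) • L) = stableBaseSet L := by
  apply le_antisymm
  · refine le_iInf fun m => (iInf_le _ m).trans ?_
    rw [smul_comm]
    exact baseLocus_nsmul_le _ _
  · refine le_iInf fun m => (iInf_le _ (m * n)).trans ?_
    rw [PNat.mul_coe, mul_smul]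

lemma exists_nsmul_eq_of_tmul_eq {M : Type u} [AddCommGroup M] {L L' : M}
    (h : L ⊗ₜ[ℤ] (1 : ℚ) = L' ⊗ₜ[ℤ] (1 : ℚ)) : ∃ n : ℕ+, (n : ℕ) • L = (n : ℕ) • L' := by
  have h' : TensorProduct.mk ℤ ℚ M 1 L = TensorProduct.mk ℤ ℚ M 1 L' :=
    congrArg (TensorProduct.comm ℤ M ℚ) h
  obtain ⟨c, hc⟩ := (IsLocalizedModule.eq_iff_exists (nonZeroDivisors ℤ)
    (TensorProduct.mk ℤ ℚ M 1)).1 h'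
  have hc0 : (c : ℤ) ≠ 0 := nonZeroDivisors.ne_zero c.2
  refine ⟨⟨(c : ℤ).natAbs, Int.natAbs_pos.2 hc0⟩, ?_⟩
  change (c : ℤ) • L = (c : ℤ) • L' at hc
  rcases Int.natAbs_eq (c : ℤ) with h1 | h1
  · rw [h1, natCast_zsmul, natCast_zsmul] at hc
    exact hc
  · rw [h1, neg_smul, neg_smul, natCast_zsmul, natCast_zsmul] at hc
    exact neg_injective hc

/-- Every `ℚ`-divisor has a positive multiple that is Cartier. -/
lemma QDivisor.exists_cartier (D : QDivisor Y) :
    ∃ (b : ℕ+) (L : CartierDivisor Y), (b : ℕ) • D = L ⊗ₜ[ℤ] (1 : ℚ) := by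
  induction D using TensorProduct.induction_on with
  | zero => exact ⟨1, 0, by simp⟩
  | tmul L q =>
    refine ⟨⟨q.den, q.den_pos⟩, q.num • L, ?_⟩
    rw [TensorProduct.smul_tmul, ← TensorProduct.tmul_smul]
    congr 1
    simp [mul_comm, Rat.mul_den_eq_num]
  | add D E hD hE =>
    obtain ⟨b, L, hL⟩ := hD
    obtain ⟨c, M, hM⟩ := hE
    refine ⟨b * c, (c : ℕ) • L + (b : ℕ) • M, ?_⟩
    rw [TensorProduct.add_tmul, ← TensorProduct.smul_tmul', ← TensorProduct.smul_tmul', ← hL,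
      ← hM, PNat.mul_coe, smul_add, mul_smul (b : ℕ) (c : ℕ) E, mul_comm, mul_smul]

/-- The stable base locus of a `ℚ`-divisor does not depend on the chosen Cartier multiple. -/
lemma QDivisor.stableBaseSet_eq (D : QDivisor Y) (b : ℕ+) (L : CartierDivisor Y)
    (h : (b : ℕ) • D = L ⊗ₜ[ℤ] (1 : ℚ)) : D.stableBaseSet = BaseLoci.stableBaseSet L := by
  apply le_antisymm
  · exact (iInf_le _ b).trans ((iInf_le _ L).trans (iInf_le _ h))
  · refine le_iInf fun c => le_iInf fun M => le_iInf fun hM => ?_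
    have key : ((c : ℕ) • L) ⊗ₜ[ℤ] (1 : ℚ) = ((b : ℕ) • M) ⊗ₜ[ℤ] (1 : ℚ) := by
      rw [← TensorProduct.smul_tmul', ← TensorProduct.smul_tmul', ← h, ← hM, smul_comm]
    obtain ⟨n, hn⟩ := exists_nsmul_eq_of_tmul_eq key
    rw [← stableBaseSet_nsmul L c, ← stableBaseSet_nsmul _ n, hn, stableBaseSet_nsmul,
      stableBaseSet_nsmul]

/-- The stable base locus of a `ℚ`-divisor as a reduced closed subscheme of `Y`, given by its
ideal sheaf. -/
def QDivisor.stableBaseLocus (D : QDivisor Y) : Y.IdealSheafData :=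
  Scheme.IdealSheafData.vanishingIdeal D.stableBaseSet

/-- The reduced closed subscheme associated to the scheme-theoretic inverse image `f⁻¹ Z` of a
closed subscheme `Z` of `Y` (closed subschemes being given by their ideal sheaves). -/
def reducedPreimage (f : X ⟶ Y) (Z : Y.IdealSheafData) : X.IdealSheafData :=
  (Z.comap f).radical

end BaseLoci

end

/-! Pulling back sections gives `B(f^*L) ⊆ f⁻¹ B(L)` at once. For the converse, let a section `g` of
`f^*L` be nonzero at `x`, and let `p`, of degree `d`, be its minimal polynomial over `k(Y)`. If `φ`
is a local equation of `L` at `y`, suitably chosen, then `g φ` is integral over `𝒪_{Y,y}`. By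
normality its minimal polynomial, which is `p` with roots scaled by `φ`, has coefficients in
`𝒪_{Y,y}`. So the `i`-th coefficient of `p` is a global section of `(d - i)L`. If all of these with
`i < d` vanished at `f x`, the scaled polynomial would reduce to `T^d`, although it has the unit `g
φ` of `𝒪_{X,x}` as a root. Using all coefficients, not only the norm, makes nonvanishing at the
single point `x` of the fibre enough. The argument is carried by `map_minpoly_mul_eq_scaleRoots`,
`exists_isUnit_coeff_of_eval₂_eq_zero` and `exists_notMem_baseLocus_nsmul`. -/

noncomputable section

namespace BaseLoci

/-! ### Minimal polynomials over integrally closed rings, and unit roots over local rings. -/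

section Algebra

open Polynomial

/-- If `g c` is integral over an integrally closed domain `R` with fraction field `K`, where
`c ∈ Kˣ`, then the minimal polynomial of `g` over `K`, with roots rescaled by `c`, is the minimal
polynomial of `g c` over `R`. -/
lemma map_minpoly_mul_eq_scaleRoots {R K L : Type*} [CommRing R] [IsDomain R]
    [IsIntegrallyClosed R] [Field K] [Field L] [Algebra R K] [IsFractionRing R K] [Algebra K L]
    [Algebra R L] [IsScalarTower R K L] {g : L} {c : K} (hc : c ≠ 0)
    (h : IsIntegral R (g * algebraMap K L c)) :
    (minpoly R (g * algebraMap K L c)).map (algebraMap R K) = (minpoly K g).scaleRoots c := by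
  have hg : IsIntegral K g := by
    have := (h.tower_top (A := K)).mul (isIntegral_algebraMap (R := K) (A := L) (x := c⁻¹))
    rwa [mul_assoc, ← map_mul, mul_inv_cancel₀ hc, map_one, mul_one] at this
  rw [← minpoly.isIntegrallyClosed_eq_field_fractions' K h, mul_comm, ← Algebra.smul_def]
  exact IsIntegrallyClosed.minpoly_smul hc hg

/-- A monic polynomial over a local ring with a unit root in a local extension has a non-leading
coefficient which is a unit. -/
lemma exists_isUnit_coeff_of_eval₂_eq_zero {R S : Type*} [CommRing R] [CommRing S]
    [IsLocalRing R] [IsLocalRing S] (φ : R →+* S) [IsLocalHom φ] {P : R[X]} (hP : P.Monic)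
    {u : S} (hu : IsUnit u) (h : P.eval₂ φ u = 0) :
    ∃ i < P.natDegree, IsUnit (P.coeff i) := by
  by_contra! hcon
  -- Since `φ` is local, nonunit coefficients die in the residue field of `S`; `X ^ n` has no
  -- nonzero root there.
  have hmap : P.map ((IsLocalRing.residue S).comp φ) = X ^ P.natDegree := by
    ext i
    rw [coeff_map, coeff_X_pow, RingHom.comp_apply]
    rcases lt_trichotomy i P.natDegree with hi | rfl | hi
    · rw [if_neg hi.ne, IsLocalRing.residue_eq_zero_iff, IsLocalRing.mem_maximalIdeal,
        mem_nonunits_iff]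
      exact fun hun => hcon i hi (isUnit_of_map_unit φ _ hun)
    · simp [hP.coeff_natDegree]
    · simp [coeff_eq_zero_of_natDegree_lt hi, hi.ne']
  have h0 : (P.map ((IsLocalRing.residue S).comp φ)).eval (IsLocalRing.residue S u) = 0 := by
    rw [Polynomial.eval_map, ← hom_eval₂, h, map_zero]
  rw [hmap, eval_pow, eval_X] at h0
  exact ((hu.map (IsLocalRing.residue S)).pow _).ne_zero h0

end Algebra

/-! ### Regular rational functions and pullback of sections. -/

variable {X Y : Scheme.{u}} [IsIntegral X] [IsIntegral Y]

lemma genericPoint_mem_of_mem {U : Y.Opens} {y : Y} (hy : y ∈ U) : genericPoint Y ∈ U :=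
  ((genericPoint_spec Y).mem_open_set_iff U.isOpen).2 ⟨y, trivial, hy⟩

/-- A rational function that is regular at all points of an open set `U` is a section over `U`. -/
lemma exists_germ_eq_of_forall_regular {U : Y.Opens} (hU : genericPoint Y ∈ U)
    (h : Y.functionField)
    (hreg : ∀ y ∈ U, ∃ a : Y.presheaf.stalk y, algebraMap _ Y.functionField a = h) :
    ∃ s : Γ(Y, U), Y.presheaf.germ U (genericPoint Y) hU s = h := by
  have hloc : ∀ y : U, ∃ (V : Y.Opens) (hV : V ≤ U) (hy : y.1 ∈ V) (s : Γ(Y, V)),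
      Y.presheaf.germ V (genericPoint Y) (genericPoint_mem_of_mem hy) s = h := by
    rintro ⟨y, hy⟩
    obtain ⟨a, ha⟩ := hreg y hy
    obtain ⟨V, hyV, s, rfl⟩ := Y.presheaf.exists_germ_eq a
    refine ⟨V ⊓ U, inf_le_right, ⟨hyV, hy⟩, Y.presheaf.map (homOfLE inf_le_left).op s, ?_⟩
    rw [algebraMap_germ y V hyV (genericPoint_mem_of_mem hyV)] at ha
    rw [← ha]
    exact Y.presheaf.germ_res_apply (homOfLE inf_le_left) _ _ s
  choose V hVU hyV s hs using hloc
  obtain ⟨t, ht, -⟩ := Y.sheaf.existsUnique_gluing' V U (fun i => homOfLE (hVU i))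
    (fun y hy => Opens.mem_iSup.2 ⟨⟨y, hy⟩, hyV _⟩) s (by
      intro i j
      have hgen : genericPoint Y ∈ V i ⊓ V j :=
        ⟨genericPoint_mem_of_mem (hyV i), genericPoint_mem_of_mem (hyV j)⟩
      -- On an integral scheme sections are determined by their generic germ, and here both germs
      -- are `h`.
      apply germ_injective_of_isIntegral Y (genericPoint Y) hgen
      refine (Y.presheaf.germ_res_apply _ _ _ _).trans
        (Eq.trans ?_ (Y.presheaf.germ_res_apply _ _ _ _).symm)
      exact (hs i).trans (hs j).symm)
  refine ⟨t, ?_⟩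
  rw [← hs ⟨_, hU⟩, ← ht]
  exact (Y.presheaf.germ_res_apply _ _ _ _).symm

lemma isLocalEquation_pullback (f : X ⟶ Y) [IsDominant f] {L : CartierDivisor Y} {x : X}
    {φ : (Y.functionField)ˣ} (h : IsLocalEquation L (f x) φ) :
    IsLocalEquation (pullback f L) x (Units.map (functionFieldMap f).toMonoidHom φ) :=
  congrArg (stalkPullback f x) h

/-- Membership in `H⁰(Y, 𝒪_Y(L))` can be tested on one local equation at each point. -/
lemma mem_globalSections_of_exists {L : CartierDivisor Y} {g : Y.functionField}
    (h : ∀ y, ∃ φ, IsLocalEquation L y φ ∧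
      ∃ a : Y.presheaf.stalk y, algebraMap _ Y.functionField a = g * φ) :
    g ∈ globalSections L := by
  intro y ψ hψ
  obtain ⟨φ, hφ, ha⟩ := h y
  exact exists_regular_of_isLocalEquation hφ hψ ha

/-- Nonvanishing of a section can be tested on any given local equation. -/
lemma exists_unit_of_not_vanishesAt {L : CartierDivisor Y} {g : Y.functionField}
    (hg : g ∈ globalSections L) {y : Y} (hv : ¬ VanishesAt L g y) {ψ : (Y.functionField)ˣ}
    (hψ : IsLocalEquation L y ψ) :
    ∃ u : (Y.presheaf.stalk y)ˣ,
      algebraMap _ Y.functionField (u : Y.presheaf.stalk y) = g * ψ := by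
  obtain ⟨φ, hφ, u, hu⟩ := (not_vanishesAt_iff hg y).1 hv
  obtain ⟨c, hc⟩ : φ⁻¹ * ψ ∈ stalkUnits Y y := QuotientGroup.eq.1 (hφ.symm.trans hψ)
  have hc' : algebraMap _ Y.functionField (c : Y.presheaf.stalk y) =
      ((φ⁻¹ * ψ : (Y.functionField)ˣ) : Y.functionField) := congrArg Units.val hc
  refine ⟨u * c, ?_⟩
  rw [Units.val_mul, map_mul, hu, hc', Units.val_mul, mul_assoc,
    ← mul_assoc (φ : Y.functionField), Units.mul_inv, one_mul]

lemma mem_globalSections_pullback (f : X ⟶ Y) [IsDominant f] {L : CartierDivisor Y}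
    {g : Y.functionField} (hg : g ∈ globalSections L) :
    functionFieldMap f g ∈ globalSections (pullback f L) := by
  refine mem_globalSections_of_exists fun x => ?_
  obtain ⟨φ, hφ⟩ := exists_isLocalEquation L (f x)
  obtain ⟨a, ha⟩ := hg _ φ hφ
  refine ⟨_, isLocalEquation_pullback f hφ, f.stalkMap x a, ?_⟩
  rw [← functionFieldMap_algebraMap, ha, map_mul]
  rfl

/-- Base loci of pullbacks are contained in preimages of base loci. -/
lemma mem_baseLocus_of_mem_baseLocus_pullback (f : X ⟶ Y) [IsDominant f] {L : CartierDivisor Y}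
    {x : X} (hx : x ∈ baseLocus (pullback f L)) : f x ∈ baseLocus L := by
  intro g hg
  by_contra hv
  obtain ⟨φ, hφ⟩ := exists_isLocalEquation L (f x)
  obtain ⟨u, hu⟩ := exists_unit_of_not_vanishesAt hg hv hφ
  refine (not_vanishesAt_iff (mem_globalSections_pullback f hg) x).2
    ⟨_, isLocalEquation_pullback f hφ, Units.map (f.stalkMap x).hom.toMonoidHom u, ?_⟩
    (hx _ (mem_globalSections_pullback f hg))
  refine (functionFieldMap_algebraMap f x u).symm.trans ?_
  rw [hu, map_mul]
  rfl

/-! ### Integrality of sections of the pullback, and descent to `Y`. -/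

lemma functionFieldMap_germ (f : X ⟶ Y) [IsDominant f] {U : Y.Opens} (hU : genericPoint Y ∈ U)
    (hU' : genericPoint X ∈ f ⁻¹ᵁ U) (s : Γ(Y, U)) :
    functionFieldMap f (Y.presheaf.germ U (genericPoint Y) hU s) =
      X.presheaf.germ (f ⁻¹ᵁ U) (genericPoint X) hU' (f.app U s) := by
  have h := f.germ_stalkMap U (genericPoint X) hU'
  have h2 := congr($h s)
  simp only [CommRingCat.comp_apply] at h2
  rw [← h2, functionFieldMap, CommRingCat.hom_comp, RingHom.comp_apply]
  congr 1
  exact Y.presheaf.germ_stalkSpecializes_apply _ _ _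

/-- In terms of a suitable local equation of `L` at `y`, sections of the pullback of `L` along an
integral morphism are integral over `𝒪_{Y,y}`. -/
lemma exists_isIntegralElem_of_mem_globalSections_pullback (f : X ⟶ Y) [IsDominant f]
    [IsIntegralHom f] {L : CartierDivisor Y} {g : X.functionField}
    (hg : g ∈ globalSections (pullback f L)) (y : Y) :
    ∃ φ, IsLocalEquation L y φ ∧
      ((functionFieldMap f).comp (algebraMap (Y.presheaf.stalk y) Y.functionField)).IsIntegralElem
        (g * functionFieldMap f φ) := by
  -- The local equation must be valid on a neighbourhood, not just at `y`, so that `g φ` is a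
  -- section over the whole preimage of an affine open, where integrality of `f` applies.
  obtain ⟨U, hyU, φ, hφ⟩ := (Additive.toMul L).2 y
  obtain ⟨_, ⟨V, hV, rfl⟩, hyV, hVU⟩ :=
    Y.isBasis_affineOpens.exists_subset_of_mem_open hyU U.isOpen
  have hgenV : genericPoint Y ∈ V := genericPoint_mem_of_mem hyV
  have hgen : genericPoint X ∈ f ⁻¹ᵁ V := by
    change f (genericPoint X) ∈ V
    rwa [genericPoint_map]
  obtain ⟨s, hs⟩ := exists_germ_eq_of_forall_regular hgen (g * functionFieldMap f φ)
    fun x hx => hg x _ (isLocalEquation_pullback f (hφ (f x) (hVU hx)))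
  refine ⟨φ, hφ y hyU, ?_⟩
  obtain ⟨P, hP, hPs⟩ := IsIntegralHom.isIntegral_app f V hV s
  refine ⟨P.map (Y.presheaf.germ V y hyV).hom, hP.map _, ?_⟩
  have hcomp : ((functionFieldMap f).comp
      (algebraMap (Y.presheaf.stalk y) Y.functionField)).comp (Y.presheaf.germ V y hyV).hom =
      (X.presheaf.germ (f ⁻¹ᵁ V) (genericPoint X) hgen).hom.comp (f.app V).hom := by
    ext t
    simp only [RingHom.comp_apply]
    rw [← functionFieldMap_germ f hgenV hgen]
    congr 1
    exact algebraMap_germ y V hyV hgenV t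
  rw [Polynomial.eval₂_map, hcomp, ← hs]
  refine (Polynomial.hom_eval₂ P _
    (X.presheaf.germ (f ⁻¹ᵁ V) (genericPoint X) hgen).hom s).symm.trans ?_
  rw [hPs, map_zero]

/-- If some section of the pullback of `L` along an integral dominant morphism to a normal scheme
does not vanish at `x`, then some section of a positive multiple of `L` does not vanish at `f x`,
namely a coefficient of the minimal polynomial. -/
lemma exists_notMem_baseLocus_nsmul (f : X ⟶ Y) [IsDominant f] [IsIntegralHom f]
    (hY : IsNormal Y) {L : CartierDivisor Y} {x : X} (hx : x ∉ baseLocus (pullback f L)) :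
    ∃ n : ℕ+, f x ∉ baseLocus ((n : ℕ) • L) := by
  obtain ⟨g, hg, hv⟩ : ∃ g ∈ globalSections (pullback f L), ¬ VanishesAt (pullback f L) g x := by
    by_contra! h
    exact hx h
  let : Algebra Y.functionField X.functionField := (functionFieldMap f).toAlgebra
  set p := minpoly Y.functionField g with hp
  -- The single polynomial `p` governs every point of `Y`; only the scaling `φ` depends on `y`. This
  -- is what makes its coefficients global sections.
  have key : ∀ y : Y, ∃ φ, IsLocalEquation L y φ ∧ ∃ P : Polynomial (Y.presheaf.stalk y),
      P.Monic ∧ P.map (algebraMap _ Y.functionField) = p.scaleRoots φ ∧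
      P.eval₂ ((functionFieldMap f).comp (algebraMap _ Y.functionField))
        (g * functionFieldMap f φ) = 0 := by
    intro y
    obtain ⟨φ, hφ, hint⟩ := exists_isIntegralElem_of_mem_globalSections_pullback f hg y
    let : Algebra (Y.presheaf.stalk y) X.functionField :=
      ((functionFieldMap f).comp (algebraMap _ Y.functionField)).toAlgebra
    have : IsScalarTower (Y.presheaf.stalk y) Y.functionField X.functionField :=
      IsScalarTower.of_algebraMap_eq' rfl
    have := hY y
    exact ⟨φ, hφ, _, minpoly.monic hint, map_minpoly_mul_eq_scaleRoots φ.ne_zero hint,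
      minpoly.aeval _ _⟩
  have hcoeff : ∀ {y : Y} {φ : (Y.functionField)ˣ} {P : Polynomial (Y.presheaf.stalk y)},
      P.map (algebraMap _ Y.functionField) = p.scaleRoots φ → ∀ i,
      algebraMap _ Y.functionField (P.coeff i) =
        p.coeff i * ((φ ^ (p.natDegree - i) : (Y.functionField)ˣ) : Y.functionField) := by
    intro y φ P hP i
    rw [← Polynomial.coeff_map, hP, Polynomial.coeff_scaleRoots, Units.val_pow_eq_pow_val]
  obtain ⟨φ, hφ, P, hPm, hPp, hP0⟩ := key (f x)
  obtain ⟨u, hu⟩ := exists_unit_of_not_vanishesAt hg hv (isLocalEquation_pullback f hφ)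
  have hroot : P.eval₂ (f.stalkMap x).hom (u : X.presheaf.stalk x) = 0 := by
    apply algebraMap_stalk_injective x
    rw [map_zero, Polynomial.hom_eval₂, hu, ← hP0]
    congr 1
    ext a
    exact (functionFieldMap_algebraMap f x a).symm
  obtain ⟨i, hi, hunit⟩ := exists_isUnit_coeff_of_eval₂_eq_zero _ hPm u.isUnit hroot
  have hdeg : P.natDegree = p.natDegree := by
    rw [← Polynomial.natDegree_scaleRoots p φ, ← hPp,
      Polynomial.natDegree_map_eq_of_injective (algebraMap_stalk_injective (f x))]
  have hmem : p.coeff i ∈ globalSections ((p.natDegree - i) • L) := by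
    refine mem_globalSections_of_exists fun y => ?_
    obtain ⟨ψ, hψ, Q, -, hQp, -⟩ := key y
    exact ⟨_, isLocalEquation_nsmul hψ _, Q.coeff i, hcoeff hQp i⟩
  -- The multiple is positive because the unit coefficient is not the leading one.
  refine ⟨⟨p.natDegree - i, Nat.sub_pos_of_lt (hdeg ▸ hi)⟩, fun hB => ?_⟩
  exact (not_vanishesAt_iff hmem (f x)).2
    ⟨_, isLocalEquation_nsmul hφ _, hunit.unit, hcoeff hPp i⟩ (hB _ hmem)

/-! ### Stable base loci and the final comparison. -/

lemma mem_stableBaseSet_iff {L : CartierDivisor Y} {y : Y} :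
    y ∈ stableBaseSet L ↔ ∀ m : ℕ+, y ∈ baseLocus ((m : ℕ) • L) := by
  simp [stableBaseSet, ← SetLike.mem_coe]

/-- The stable base locus of a Cartier divisor is compatible with pullback along integral
dominant morphisms to a normal scheme. -/
lemma mem_stableBaseSet_pullback_iff (f : X ⟶ Y) [IsDominant f] [IsIntegralHom f]
    (hY : IsNormal Y) (L : CartierDivisor Y) (x : X) :
    x ∈ stableBaseSet (pullback f L) ↔ f x ∈ stableBaseSet L := by
  simp only [mem_stableBaseSet_iff, ← map_nsmul]
  refine ⟨fun h m => mem_baseLocus_of_mem_baseLocus_pullback f (h m), fun h m => ?_⟩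
  by_contra hx
  -- Applied to `m • L`, this reaches the multiple `n * m` of `L`; allowing all multiples absorbs
  -- the unknown `n`.
  obtain ⟨n, hn⟩ := exists_notMem_baseLocus_nsmul f hY hx
  refine hn ?_
  rw [← mul_smul]
  exact h (n * m)

/-- A single `b` clears denominators for both `D` and its pullback, which reduces the claim to
Cartier divisors. -/
lemma QDivisor.mem_stableBaseSet_pullback_iff (f : X ⟶ Y) [IsDominant f] [IsIntegralHom f]
    (hY : IsNormal Y) (D : QDivisor Y) (x : X) :
    x ∈ (QDivisor.pullback f D).stableBaseSet ↔ f x ∈ D.stableBaseSet := by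
  obtain ⟨b, L, hL⟩ := D.exists_cartier
  rw [D.stableBaseSet_eq b L hL, (QDivisor.pullback f D).stableBaseSet_eq b (BaseLoci.pullback f L)]
  · exact BaseLoci.mem_stableBaseSet_pullback_iff f hY L x
  · rw [← map_nsmul, hL]
    rfl

end BaseLoci

end

theorem theorem3p1 (k : Type u) [Field k] [PerfectField k] (X Y : Scheme.{u})
    [X.Over (Spec (CommRingCat.of k))] [Y.Over (Spec (CommRingCat.of k))]
    [IsIntegral X] [IsIntegral Y]
    (hX : BaseLoci.IsProjective k X) (hY : BaseLoci.IsProjective k Y)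
    (hXn : BaseLoci.IsNormal X) (hYn : BaseLoci.IsNormal Y)
    (f : X ⟶ Y) [f.IsOver (Spec (CommRingCat.of k))] [IsFinite f] [Surjective f]
    (hf : BaseLoci.IsSeparableMorphism f) (D : BaseLoci.QDivisor Y) :
    (BaseLoci.QDivisor.pullback f D).stableBaseLocus =
      BaseLoci.reducedPreimage f D.stableBaseLocus := by
  -- A radical ideal sheaf is the vanishing ideal of its support, so only closed subsets of `X`
  -- remain to be compared.
  rw [BaseLoci.reducedPreimage, ← Scheme.IdealSheafData.vanishingIdeal_support,
    BaseLoci.QDivisor.stableBaseLocus, BaseLoci.QDivisor.stableBaseLocus]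
  congr 1
  ext x
  rw [Scheme.IdealSheafData.support_comap]
  refine (BaseLoci.QDivisor.mem_stableBaseSet_pullback_iff f hYn D x).trans ?_
  rw [Closeds.coe_preimage, Set.mem_preimage, Scheme.IdealSheafData.coe_support_vanishingIdeal]
  rfl
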